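/- Consider a transmitter with initial energy $E_0 \ge 0$ that harvests the energies $E_1,\dots,E_N \ge 0$ at the times $s_1<\dots<s_N$, and put $s_0=0<s_1<\dots<s_N<s_{N+1}=D$, where $D$ is the deadline. Let $a,b\ge 0$ and $T_c>T_e$ be constants and put $T_\delta = T_c-T_e$. For a power policy $P\ge 0$ on $[0,D]$, let $T$ be the resulting temperature, i.e. the solution of $T'(t)=aP(t)-b(T(t)-T_e)$ with $T(0)=T_e$, \[ T(t)=e^{-bt}\Big(\int_0^t e^{b\tau}\big(aP(\tau)+bT_e\big)\,d\tau+T_e\Big). \] Let $P$ be an optimal policy, that is, one that maximizes $\int_0^D \frac12\log_2(1+P(t))\,dt$ over all measurable $P:[0,D]\to[0,\infty)$ such that, for all $t\in[0,D]$, $T(t)\le T_c$ and $\int_0^tP(\tau)\,d\tau\le\sum_{i=0}^{h(t)}E_i$, where $h(t)=\max\{k\le N:s_k<t\}$ (and $h(0)=0$). Optimal policies are determined only up to null sets; the claim is about a suitable version: after changing $P$ on a set of measure zero (which affects neither feasibility, nor throughput, nor $T$), the following holds for every $t_h\in[0,D)$. If $T(t_h)=T_c$, then $P$ is continuous at $t_h$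 and \[ P(t_h)=\frac{T_\delta b}{a}. \] (If $a=0$, then $T\equiv T_e<T_c$, so there is no such $t_h$.) -/

import Mathlib

open MeasureTheory Set

/-- The data of the model: an energy harvesting transmitter with linear heat dynamics
`T' = a P - b (T - Te)`, operated on `[0, D]`, where `D = s (N + 1)`.  The energy `E k` becomes
available at time `s k` for `k = 0, …, N`, with `s 0 = 0` (the values of `s` beyond `N + 1` and
of `E` beyond `N` play no role). -/
structure EHTransmitter where
  /-- heating coefficient -/
  a : ℝ
  /-- cooling coefficient -/
  b : ℝ
  /-- temperature of the environment, which is also the initial temperature -/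
  Te : ℝ
  /-- critical temperature -/
  Tc : ℝ
  /-- deadline -/
  D : ℝ
  /-- number of energy arrivals strictly between time `0` and the deadline -/
  N : ℕ
  /-- energy arrival instants -/
  s : ℕ → ℝ
  /-- amounts of harvested energy -/
  E : ℕ → ℝ
  a_nonneg : 0 ≤ a
  b_nonneg : 0 ≤ b
  Te_lt_Tc : Te < Tc
  s_zero : s 0 = 0
  s_lt : ∀ k ≤ N, s k < s (k + 1)
  s_last : s (N + 1) = D
  E_nonneg : ∀ k ≤ N, 0 ≤ E k

namespace EHTransmitter

/-- The largest allowed deviation `T_δ = T_c - T_e` from the environment temperature. -/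
def Tδ (M : EHTransmitter) : ℝ := M.Tc - M.Te

/-- `h(t) = max {k : s_k < t}`, the index of the last arrival before `t`
(equal to `0` at `t = 0`, where there is none). -/
noncomputable def h (M : EHTransmitter) (t : ℝ) : ℕ :=
  open Classical in Nat.findGreatest (fun k => M.s k < t) M.N

/-- The temperature at time `t` under the power policy `P`: the solution of
`T' = a P - b (T - Te)` with `T(0) = Te`. -/
noncomputable def temperature (M : EHTransmitter) (P : ℝ → ℝ) (t : ℝ) : ℝ :=
  Real.exp (-(M.b * t)) *
    ((∫ τ in (0 : ℝ)..t, Real.exp (M.b * τ) * (M.a * P τ + M.b * M.Te)) + M.Te)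

/-- Feasible power policies: nonnegative functions on `[0, D]`, measurable (up to a null set) with
finite total energy, obeying energy causality and the temperature constraint. -/
structure IsFeasible (M : EHTransmitter) (P : ℝ → ℝ) : Prop where
  nonneg : ∀ t ∈ Icc 0 M.D, 0 ≤ P t
  integrable : IntegrableOn P (Icc 0 M.D)
  energy : ∀ t ∈ Icc 0 M.D, ∫ τ in (0 : ℝ)..t, P τ ≤ ∑ i ∈ Finset.range (M.h t + 1), M.E i
  temp : ∀ t ∈ Icc 0 M.D, M.temperature P t ≤ M.Tc

/-- Number of bits sent by the deadline. -/
noncomputable def throughput (M : EHTransmitter) (P : ℝ → ℝ) : ℝ :=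
  ∫ t in (0 : ℝ)..M.D, 1 / 2 * Real.logb 2 (1 + P t)

/-- `P` is a throughput optimal policy. -/
structure IsOptimal (M : EHTransmitter) (P : ℝ → ℝ) : Prop where
  feasible : M.IsFeasible P
  max : ∀ Q : ℝ → ℝ, M.IsFeasible Q → M.throughput Q ≤ M.throughput P

end EHTransmitter

/-! Put F(t) = e^(bt) (1 + P(t)). If F is larger on an early set than on a later one, some heat
e^(bt) P can be postponed. Accumulated heat never increases, and neither does spent energy, since
heat costs e^(-bt) per unit, decreasingly in t; both constraints survive, while concavity of the
logarithm raises the throughput. So for an optimal policy F is nondecreasing off a null set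
(`IsOptimal.no_exchange`, `IsOptimal.exists_monotoneOn`). The temperature constraint says that the
heat a ∫ e^(bτ) P stays below the ceiling Tδ e^(bt), with equality at t_h. Comparing growth rates
just before and just after t_h bounds the left limit of F from below and the right limit from above
by the same level k = (a + Tδ b) e^(b t_h) / a (`IsFeasible.le_of_ae_le`, `IsFeasible.ge_of_ae_ge`).
Monotonicity then forces continuity and the value k. -/

namespace EHTransmitter

variable {M : EHTransmitter} {P Q : ℝ → ℝ}

/-! ### Temperature, throughput and changes on null sets -/

theorem s_nonneg (M : EHTransmitter) : ∀ k ≤ M.N + 1, 0 ≤ M.s k := by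
  intro k
  induction k with
  | zero => intro _; exact M.s_zero.ge
  | succ k ih => intro hk; exact (ih (by omega)).trans (M.s_lt k (by omega)).le

theorem D_pos (M : EHTransmitter) : 0 < M.D := by
  have := M.s_nonneg M.N (by omega)
  have := M.s_lt M.N le_rfl
  rw [M.s_last] at this
  linarith

theorem Tδ_pos (M : EHTransmitter) : 0 < M.Tδ := sub_pos.2 M.Te_lt_Tc

theorem IsFeasible.intervalIntegrable (hP : M.IsFeasible P) {x y : ℝ} (hx : x ∈ Icc 0 M.D)
    (hy : y ∈ Icc 0 M.D) : IntervalIntegrable P volume x y :=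
  (intervalIntegrable_iff_integrableOn_Icc_of_le M.D_pos.le).2 hP.integrable |>.mono_set <| by
    rw [uIcc_of_le M.D_pos.le]
    exact uIcc_subset_Icc hx hy

/-- The temperature, written as the deviation from the temperature of the environment. -/
theorem temperature_eq {t : ℝ} (hP : IntervalIntegrable P volume 0 t) :
    M.temperature P t =
      M.Te + M.a * (Real.exp (-(M.b * t)) * ∫ τ in (0 : ℝ)..t, Real.exp (M.b * τ) * P τ) := by
  have hexp : Continuous fun τ : ℝ => Real.exp (M.b * τ) := by fun_prop
  have h1 : ∫ τ in (0 : ℝ)..t, Real.exp (M.b * τ) * M.b = Real.exp (M.b * t) - 1 := by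
    rw [intervalIntegral.integral_eq_sub_of_hasDerivAt (f := fun τ => Real.exp (M.b * τ))]
    · simp
    · intro x _
      simpa using ((hasDerivAt_id x).const_mul M.b).exp
    · exact (by fun_prop : Continuous fun τ : ℝ => Real.exp (M.b * τ) * M.b).intervalIntegrable _ _
  have h2 : ∫ τ in (0 : ℝ)..t, Real.exp (M.b * τ) * (M.a * P τ + M.b * M.Te) =
      M.a * (∫ τ in (0 : ℝ)..t, Real.exp (M.b * τ) * P τ) + M.Te * (Real.exp (M.b * t) - 1) := by
    rw [← h1, ← intervalIntegral.integral_const_mul, ← intervalIntegral.integral_const_mul,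
      ← intervalIntegral.integral_add]
    · congr 1; ext τ; ring
    · exact (hP.continuousOn_mul hexp.continuousOn).const_mul _
    · exact (by fun_prop : Continuous fun τ : ℝ =>
        M.Te * (Real.exp (M.b * τ) * M.b)).intervalIntegrable _ _
  have h3 : Real.exp (-(M.b * t)) * Real.exp (M.b * t) = 1 := by
    rw [← Real.exp_add]; simp
  rw [temperature, h2]
  linear_combination M.Te * h3

theorem ae_uIoc_of_ae_Icc {p : ℝ → Prop} (h : ∀ᵐ t, t ∈ Icc 0 M.D → p t) {t : ℝ}
    (ht : t ∈ Icc 0 M.D) : ∀ᵐ τ, τ ∈ uIoc 0 t → p τ := by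
  filter_upwards [h] with τ hτ hm
  rw [uIoc_of_le ht.1] at hm
  exact hτ ⟨hm.1.le, hm.2.trans ht.2⟩

theorem temperature_congr (h : ∀ᵐ t, t ∈ Icc 0 M.D → Q t = P t) {t : ℝ} (ht : t ∈ Icc 0 M.D) :
    M.temperature Q t = M.temperature P t := by
  rw [temperature, temperature, intervalIntegral.integral_congr_ae]
  filter_upwards [ae_uIoc_of_ae_Icc h ht] with τ hτ hm
  rw [hτ hm]

theorem throughput_congr (h : ∀ᵐ t, t ∈ Icc 0 M.D → Q t = P t) :
    M.throughput Q = M.throughput P := by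
  rw [throughput, throughput, intervalIntegral.integral_congr_ae]
  filter_upwards [ae_uIoc_of_ae_Icc h (right_mem_Icc.2 M.D_pos.le)] with τ hτ hm
  rw [hτ hm]

/-- Optimality does not depend on the values of a nonnegative policy on a null set. -/
theorem IsOptimal.congr (hP : M.IsOptimal P) (h : ∀ᵐ t, t ∈ Icc 0 M.D → Q t = P t)
    (h0 : ∀ t ∈ Icc 0 M.D, 0 ≤ Q t) : M.IsOptimal Q where
  feasible :=
    { nonneg := h0
      integrable := hP.feasible.integrable.congr_fun_ae <| by
        filter_upwards [(ae_restrict_iff' measurableSet_Icc).2 h] with t ht using ht.symm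
      energy := fun t ht => by
        rw [intervalIntegral.integral_congr_ae (ae_uIoc_of_ae_Icc h ht)]
        exact hP.feasible.energy t ht
      temp := fun t ht => by
        rw [temperature_congr h ht]
        exact hP.feasible.temp t ht }
  max := fun R hR => by
    rw [throughput_congr h]
    exact hP.max R hR

theorem IsFeasible.intervalIntegrable_log (hP : M.IsFeasible P) :
    IntervalIntegrable (fun t => Real.log (1 + P t)) volume 0 M.D := by
  rw [intervalIntegrable_iff_integrableOn_Icc_of_le M.D_pos.le]
  refine Integrable.mono' hP.integrable
    (hP.integrable.aemeasurable.const_add 1).log.aestronglyMeasurable ?_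
  filter_upwards [ae_restrict_mem measurableSet_Icc] with t ht
  have h0 := hP.nonneg t ht
  rw [Real.norm_of_nonneg (Real.log_nonneg (by linarith))]
  linarith [Real.log_le_sub_one_of_pos (show 0 < 1 + P t by linarith)]

theorem throughput_eq (P : ℝ → ℝ) :
    M.throughput P = 1 / 2 * ((∫ t in (0 : ℝ)..M.D, Real.log (1 + P t)) / Real.log 2) := by
  simp only [throughput, Real.logb]
  rw [intervalIntegral.integral_const_mul, intervalIntegral.integral_div]

/-! ### The exchange argument: postponing heat -/

section Exchange

/-- The step function that withdraws the amount `u` on `A` and adds the amount `v` on `B`. -/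
noncomputable def shift (A B : Set ℝ) (u v : ℝ) (t : ℝ) : ℝ :=
  A.indicator (fun _ => -u) t + B.indicator (fun _ => v) t

variable {A B : Set ℝ} {m u v : ℝ}

theorem shift_left (hA : ∀ t ∈ A, t < m) (hB : ∀ t ∈ B, m < t) {t : ℝ} (ht : t ∈ A) :
    shift A B u v t = -u := by
  have : t ∉ B := fun h => (hA t ht).asymm (hB t h)
  simp [shift, ht, this]

theorem shift_right (hA : ∀ t ∈ A, t < m) (hB : ∀ t ∈ B, m < t) {t : ℝ} (ht : t ∈ B) :
    shift A B u v t = v := by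
  have : t ∉ A := fun h => (hA t h).asymm (hB t ht)
  simp [shift, ht, this]

theorem shift_off {t : ℝ} (h1 : t ∉ A) (h2 : t ∉ B) : shift A B u v t = 0 := by
  simp [shift, h1, h2]

theorem integrable_shift (mA : MeasurableSet A) (mB : MeasurableSet B) (fA : volume A ≠ ⊤)
    (fB : volume B ≠ ⊤) : Integrable (shift A B u v) :=
  ((integrable_indicator_iff mA).2 (integrableOn_const fA)).add
    ((integrable_indicator_iff mB).2 (integrableOn_const fB))

theorem integral_shift_eq (mA : MeasurableSet A) (mB : MeasurableSet B) (fA : volume A ≠ ⊤)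
    (fB : volume B ≠ ⊤) {D : ℝ} (hD : 0 ≤ D) (hA : A ⊆ Ioo 0 D) (hB : B ⊆ Ioo 0 D) :
    ∫ t in (0 : ℝ)..D, shift A B u v t = volume.real B * v - volume.real A * u := by
  have h : ∀ t ∉ Ioc 0 D, shift A B u v t = 0 := fun t ht =>
    shift_off (fun h => ht (Ioo_subset_Ioc_self (hA h))) (fun h => ht (Ioo_subset_Ioc_self (hB h)))
  rw [intervalIntegral.integral_of_le hD, setIntegral_eq_integral_of_forall_compl_eq_zero h]
  simp only [shift]
  rw [integral_add ((integrable_indicator_iff mA).2 (integrableOn_const fA))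
    ((integrable_indicator_iff mB).2 (integrableOn_const fB)),
    integral_indicator_const _ mA, integral_indicator_const _ mB]
  simp only [smul_eq_mul]
  ring

/-- Postponing does not increase what has been spent so far, for a decreasing price `w`. -/
theorem integral_mul_shift_nonpos (mA : MeasurableSet A) (mB : MeasurableSet B)
    {D : ℝ} (hm : m ∈ Icc 0 D) (hA : A ⊆ Ioo 0 m) (hB : B ⊆ Ioo m D) (hu : 0 ≤ u) (hv : 0 ≤ v)
    (huv : volume.real B * v ≤ volume.real A * u) {w : ℝ → ℝ} (hw : Continuous w)
    (hanti : Antitone w) (hw0 : 0 ≤ w m) {t : ℝ} (ht : t ∈ Icc 0 D) :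
    ∫ τ in (0 : ℝ)..t, w τ * shift A B u v τ ≤ 0 := by
  have fA : volume A ≠ ⊤ := ((measure_mono hA).trans_lt measure_Ioo_lt_top).ne
  have fB : volume B ≠ ⊤ := ((measure_mono hB).trans_lt measure_Ioo_lt_top).ne
  have hA' : ∀ t ∈ A, t < m := fun t ht => (hA ht).2
  have hB' : ∀ t ∈ B, m < t := fun t ht => (hB ht).1
  have hint : ∀ x y, IntervalIntegrable (shift A B u v) volume x y := fun x y =>
    (integrable_shift mA mB fA fB).intervalIntegrable
  have key : ∫ τ in (0 : ℝ)..t, shift A B u v τ ≤ 0 := by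
    rcases le_total t m with htm | htm
    · rw [← neg_nonneg, ← intervalIntegral.integral_neg]
      refine intervalIntegral.integral_nonneg ht.1 fun τ hτ => ?_
      have h2 : τ ∉ B := fun h => (hB' τ h).not_ge (hτ.2.trans htm)
      by_cases h1 : τ ∈ A
      · rw [shift_left hA' hB' h1]; simpa
      · rw [shift_off h1 h2]; simp
    -- Past m, the total over [0, D] is nonpositive by `huv`, and the part still to come after t is
    -- nonnegative.
    · have h1 := integral_shift_eq (u := u) (v := v) mA mB fA fB (ht.1.trans ht.2)
        (hA.trans (Ioo_subset_Ioo_right hm.2)) (hB.trans (Ioo_subset_Ioo_left hm.1))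
      rw [← intervalIntegral.integral_add_adjacent_intervals (hint 0 t) (hint t D)] at h1
      have h2 : 0 ≤ ∫ τ in t..D, shift A B u v τ := by
        refine intervalIntegral.integral_nonneg ht.2 fun τ hτ => ?_
        have h2 : τ ∉ A := fun h => (hA' τ h).not_ge (htm.trans hτ.1)
        by_cases h1 : τ ∈ B
        · rw [shift_right hA' hB' h1]; exact hv
        · rw [shift_off h2 h1]
      linarith
  calc ∫ τ in (0 : ℝ)..t, w τ * shift A B u v τ
      -- Withdrawals happen at prices at least w m and additions at prices at most w m.
      ≤ ∫ τ in (0 : ℝ)..t, w m * shift A B u v τ := by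
        refine intervalIntegral.integral_mono_on ht.1 ((hint 0 t).continuousOn_mul hw.continuousOn)
          ((hint 0 t).const_mul _) fun τ _ => ?_
        by_cases h1 : τ ∈ A
        · rw [shift_left hA' hB' h1]
          have := hanti (hA' τ h1).le
          nlinarith
        by_cases h2 : τ ∈ B
        · rw [shift_right hA' hB' h2]
          exact mul_le_mul_of_nonneg_right (hanti (hB' τ h2).le) hv
        · simp [shift_off h1 h2]
    _ ≤ 0 := by
        rw [intervalIntegral.integral_const_mul]
        exact mul_nonpos_of_nonneg_of_nonpos hw0 key

/-- Postponing a suitable amount of heat keeps a policy feasible. -/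
theorem IsFeasible.add_shift (hP : M.IsFeasible P) (mA : MeasurableSet A) (mB : MeasurableSet B)
    (hm : m ∈ Icc 0 M.D) (hA : A ⊆ Ioo 0 m) (hB : B ⊆ Ioo m M.D) (hu : 0 ≤ u) (hv : 0 ≤ v)
    (huv : volume.real B * v ≤ volume.real A * u)
    (hPA : ∀ t ∈ A, u ≤ Real.exp (M.b * t) * P t) :
    M.IsFeasible fun t => P t + Real.exp (-(M.b * t)) * shift A B u v t := by
  have fA : volume A ≠ ⊤ := ((measure_mono hA).trans_lt measure_Ioo_lt_top).ne
  have fB : volume B ≠ ⊤ := ((measure_mono hB).trans_lt measure_Ioo_lt_top).ne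
  have hA' : ∀ t ∈ A, t < m := fun t ht => (hA ht).2
  have hB' : ∀ t ∈ B, m < t := fun t ht => (hB ht).1
  have hexp : Continuous fun τ : ℝ => Real.exp (-(M.b * τ)) := by fun_prop
  have hanti : Antitone fun τ : ℝ => Real.exp (-(M.b * τ)) := fun x y hxy =>
    Real.exp_le_exp.2 (neg_le_neg (mul_le_mul_of_nonneg_left hxy M.b_nonneg))
  have h0 : (0 : ℝ) ∈ Icc 0 M.D := left_mem_Icc.2 M.D_pos.le
  have hS : ∀ x y, IntervalIntegrable (shift A B u v) volume x y := fun x y =>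
    (integrable_shift mA mB fA fB).intervalIntegrable
  have hS' : ∀ x y, IntervalIntegrable (fun t => Real.exp (-(M.b * t)) * shift A B u v t)
      volume x y := fun x y => (hS x y).continuousOn_mul hexp.continuousOn
  have hinv : ∀ t : ℝ, Real.exp (-(M.b * t)) * Real.exp (M.b * t) = 1 := fun t => by
    rw [← Real.exp_add]; simp
  refine ⟨fun t ht => ?_, hP.integrable.add ?_, fun t ht => ?_, fun t ht => ?_⟩
  · have := hP.nonneg t ht
    by_cases h1 : t ∈ A
    · rw [shift_left hA' hB' h1]
      have := mul_le_mul_of_nonneg_left (hPA t h1) (Real.exp_pos (-(M.b * t))).le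
      rw [← mul_assoc, hinv] at this
      linarith
    by_cases h2 : t ∈ B
    · rw [shift_right hA' hB' h2]; positivity
    · rw [shift_off h1 h2]; simpa
  · exact (intervalIntegrable_iff_integrableOn_Icc_of_le M.D_pos.le).1 (hS' 0 M.D)
  · rw [intervalIntegral.integral_add (hP.intervalIntegrable h0 ht) (hS' 0 t)]
    -- Energy is heat at the price w = e^(-bτ); the temperature constraint below uses w = 1.
    have := integral_mul_shift_nonpos mA mB hm hA hB hu hv huv hexp hanti
      (Real.exp_pos _).le ht
    linarith [hP.energy t ht]
  · have hPt := hP.intervalIntegrable h0 ht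
    have h1 := hP.temp t ht
    rw [temperature_eq hPt] at h1
    rw [temperature_eq (hPt.add (hS' 0 t))]
    have h2 : ∫ τ in (0 : ℝ)..t,
        Real.exp (M.b * τ) * (P τ + Real.exp (-(M.b * τ)) * shift A B u v τ) =
        (∫ τ in (0 : ℝ)..t, Real.exp (M.b * τ) * P τ) + ∫ τ in (0 : ℝ)..t, shift A B u v τ := by
      rw [← intervalIntegral.integral_add (hPt.continuousOn_mul
        (by fun_prop : Continuous fun τ : ℝ => Real.exp (M.b * τ)).continuousOn) (hS 0 t)]
      congr 1; ext τ
      linear_combination shift A B u v τ * hinv τ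
    have h3 := integral_mul_shift_nonpos mA mB hm hA hB hu hv huv continuous_const
      (antitone_const (c := (1 : ℝ))) zero_le_one ht
    simp only [one_mul] at h3
    rw [h2]
    refine le_trans ?_ h1
    have := M.a_nonneg
    gcongr
    linarith

/-- For an optimal policy, `e ^ (b t) (1 + P t)` cannot be larger on an early set of positive
measure than on a late one. -/
theorem IsOptimal.no_exchange (hP : M.IsOptimal P) (mA : MeasurableSet A) (mB : MeasurableSet B)
    (hm : m ∈ Icc 0 M.D) (hA : A ⊆ Ioo 0 m) (hB : B ⊆ Ioo m M.D) (pA : 0 < volume.real A)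
    (pB : 0 < volume.real B) {c c' : ℝ} (hc : c < c')
    (hPA : ∀ t ∈ A, c' < Real.exp (M.b * t) * (1 + P t))
    (hPB : ∀ t ∈ B, Real.exp (M.b * t) * (1 + P t) < c) : False := by
  have fA : volume A ≠ ⊤ := ((measure_mono hA).trans_lt measure_Ioo_lt_top).ne
  have fB : volume B ≠ ⊤ := ((measure_mono hB).trans_lt measure_Ioo_lt_top).ne
  have hA' : ∀ t ∈ A, t < m := fun t ht => (hA ht).2
  have hB' : ∀ t ∈ B, m < t := fun t ht => (hB ht).1
  have AD : A ⊆ Ioo 0 M.D := hA.trans (Ioo_subset_Ioo_right hm.2)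
  have BD : B ⊆ Ioo 0 M.D := hB.trans (Ioo_subset_Ioo_left hm.1)
  have hF : ∀ t ∈ Icc 0 M.D, Real.exp (M.b * t) ≤ Real.exp (M.b * t) * (1 + P t) := fun t ht =>
    le_mul_of_one_le_right (Real.exp_pos _).le (by linarith [hP.feasible.nonneg t ht])
  -- This keeps the new policy nonnegative on A: there e^(bt) P > c' - e^(bm) > c' - c > u.
  have hmc : Real.exp (M.b * m) < c := by
    obtain ⟨t, ht⟩ : B.Nonempty := nonempty_iff_ne_empty.2 fun h => by simp [h] at pB
    calc Real.exp (M.b * m) ≤ Real.exp (M.b * t) :=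
          Real.exp_le_exp.2 (mul_le_mul_of_nonneg_left (hB' t ht).le M.b_nonneg)
      _ ≤ _ := hF t (Ioo_subset_Icc_self (BD ht))
      _ < c := hPB t ht
  have hc0 : 0 < c := (Real.exp_pos _).trans hmc
  -- With u = ε|B| and v = ε|A| the amounts withdrawn and added agree, and the level on A stays
  -- above that on B: c + v < c' - u.
  obtain ⟨ε, hε, hsum⟩ : ∃ ε : ℝ, 0 < ε ∧ c + ε * volume.real A < c' - ε * volume.real B := by
    refine ⟨(c' - c) / (2 * (volume.real A + volume.real B)), by
      have := sub_pos.2 hc; positivity, ?_⟩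
    have : (c' - c) / (2 * (volume.real A + volume.real B)) * (volume.real A + volume.real B)
      = (c' - c) / 2 := by field_simp
    linarith
  set α := volume.real A
  set β := volume.real B
  set u := ε * β with hu
  set v := ε * α with hv
  have u0 : 0 < u := by positivity
  have v0 : 0 < v := by positivity
  have hR := hP.feasible.add_shift mA mB hm hA hB u0.le v0.le
    (show β * v ≤ α * u from le_of_eq (by rw [hu, hv]; ring)) fun t ht => by
      have h1 := hPA t ht
      have h2 : Real.exp (M.b * t) ≤ Real.exp (M.b * m) :=
        Real.exp_le_exp.2 (mul_le_mul_of_nonneg_left (hA' t ht).le M.b_nonneg)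
      linarith
  have hle := hP.max _ hR
  have hlog2 : 0 < Real.log 2 := Real.log_pos one_lt_two
  rw [throughput_eq, throughput_eq, mul_le_mul_iff_right₀ (by norm_num),
    div_le_div_iff_of_pos_right hlog2] at hle
  -- Changing F by x changes log(1 + P) by log((F + x)/F) ≥ x/(F + x), from log q ≥ 1 - 1/q;
  -- inserting F > c' on A and F < c on B gives the two constants.
  have hlow : ∫ t in (0 : ℝ)..M.D, shift A B (u / (c' - u)) (v / (c + v)) t ≤
      ∫ t in (0 : ℝ)..M.D, (Real.log (1 + (P t + Real.exp (-(M.b * t)) * shift A B u v t)) -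
        Real.log (1 + P t)) := by
    refine intervalIntegral.integral_mono_on M.D_pos.le
      (integrable_shift mA mB fA fB).intervalIntegrable
      (hR.intervalIntegrable_log.sub hP.feasible.intervalIntegrable_log) fun t ht => ?_
    have hlog : ∀ x : ℝ, 0 < Real.exp (M.b * t) * (1 + P t) + x →
        x / (Real.exp (M.b * t) * (1 + P t) + x) ≤
          Real.log (1 + (P t + Real.exp (-(M.b * t)) * x)) - Real.log (1 + P t) := by
      intro x hx
      have hp : 0 < 1 + P t := by linarith [hP.feasible.nonneg t ht]
      have he := Real.exp_pos (M.b * t)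
      have heq : 1 + (P t + Real.exp (-(M.b * t)) * x) =
          (Real.exp (M.b * t) * (1 + P t) + x) / Real.exp (M.b * t) := by
        rw [Real.exp_neg]; field_simp; ring
      have hq : 0 < 1 + (P t + Real.exp (-(M.b * t)) * x) := by rw [heq]; positivity
      rw [← Real.log_div hq.ne' hp.ne']
      refine le_trans (le_of_eq ?_) (Real.one_sub_inv_le_log_of_pos (div_pos hq hp))
      rw [heq]
      field_simp
      ring
    by_cases h1 : t ∈ A
    · rw [shift_left hA' hB' h1, shift_left hA' hB' h1]
      have := hPA t h1
      refine le_trans ?_ (hlog _ (by linarith))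
      rw [neg_div, neg_le_neg_iff]
      exact div_le_div_of_nonneg_left u0.le (by linarith) (by linarith)
    by_cases h2 : t ∈ B
    · rw [shift_right hA' hB' h2, shift_right hA' hB' h2]
      have := hPB t h2
      have := hF t ht
      have := Real.exp_pos (M.b * t)
      refine le_trans ?_ (hlog _ (by linarith))
      exact div_le_div_of_nonneg_left v0.le (by linarith) (by linarith)
    · simp [shift_off h1 h2]
  rw [integral_shift_eq mA mB fA fB M.D_pos.le AD BD, intervalIntegral.integral_sub
    hR.intervalIntegrable_log hP.feasible.intervalIntegrable_log] at hlow
  have hgain : α * (u / (c' - u)) < β * (v / (c + v)) := by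
    rw [← mul_div_assoc, ← mul_div_assoc, show β * v = α * u by rw [hu, hv]; ring]
    exact div_lt_div_of_pos_left (by positivity) (by linarith) hsum
  linarith

end Exchange

end EHTransmitter

/-! ### Monotonicity off a null set -/

open Filter Topology in
/-- A function that is monotone on a dense part of an open interval has a monotone extension to
the interval. -/
theorem MonotoneOn.exists_extension_Ioo {f : ℝ → ℝ} {S : Set ℝ} {x y : ℝ} (hS : Dense S)
    (hf : MonotoneOn f (S ∩ Ioo x y)) :
    ∃ g : ℝ → ℝ, MonotoneOn g (Ioo x y) ∧ EqOn g f (S ∩ Ioo x y) := by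
  have hmem : ∀ t ∈ Ioo x y, ∀ r ∈ S ∩ Ioc x t, r ∈ S ∩ Ioo x y := fun t ht r hr =>
    ⟨hr.1, hr.2.1, hr.2.2.trans_lt ht.2⟩
  -- Density of S supplies points before t and beyond t', so these suprema are over nonempty sets
  -- bounded above.
  refine ⟨fun t => sSup (f '' (S ∩ Ioc x t)), fun t ht t' ht' htt => ?_, fun t ht => ?_⟩
  · obtain ⟨r, hr, hxr, hrt⟩ := hS.exists_between ht.1
    obtain ⟨z, hz, htz, hzy⟩ := hS.exists_between ht'.2
    refine csSup_le_csSup ⟨f z, ?_⟩ ⟨f r, r, ⟨hr, hxr, hrt.le⟩, rfl⟩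
      (image_mono (inter_subset_inter_right _ (Ioc_subset_Ioc_right htt)))
    rintro _ ⟨w, hw, rfl⟩
    exact hf (hmem t' ht' w hw) ⟨hz, ht'.1.trans htz, hzy⟩ (hw.2.2.trans htz.le)
  · refine IsGreatest.csSup_eq ⟨⟨t, ⟨ht.1, ht.2.1, le_rfl⟩, rfl⟩, ?_⟩
    rintro _ ⟨w, hw, rfl⟩
    exact hf (hmem t ht.2 w hw) ht hw.2.2

namespace EHTransmitter

variable {M : EHTransmitter} {P : ℝ → ℝ}

theorem exists_measurable_subset_of_not_ae {p : ℝ → Prop} {x y : ℝ}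
    (hp : NullMeasurableSet {t | t ∈ Ioo x y ∧ ¬ p t}) (h : ¬ ∀ᵐ t, t ∈ Ioo x y → p t) :
    ∃ A, MeasurableSet A ∧ A ⊆ Ioo x y ∧ (∀ t ∈ A, ¬ p t) ∧ 0 < volume.real A := by
  obtain ⟨A, hAs, mA, hA⟩ := hp.exists_measurable_subset_ae_eq
  have hAI : A ⊆ Ioo x y := fun t ht => (hAs ht).1
  refine ⟨A, mA, hAI, fun t ht => (hAs ht).2, ENNReal.toReal_pos ?_
    ((measure_mono hAI).trans_lt measure_Ioo_lt_top).ne⟩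
  rw [measure_congr hA]
  rw [ae_iff] at h
  simpa only [Classical.not_imp] using h

/-- If both alternatives failed, the exceptional sets before and after m would contain measurable
sets of positive measure, which is the situation of `IsOptimal.no_exchange`. -/
theorem IsOptimal.ae_le_or_ae_ge (hP : M.IsOptimal P) {m : ℝ} (hm : m ∈ Icc 0 M.D) {c c' : ℝ}
    (hc : c < c') :
    (∀ᵐ t, t ∈ Ioo 0 m → Real.exp (M.b * t) * (1 + P t) ≤ c') ∨
      ∀ᵐ t, t ∈ Ioo m M.D → c ≤ Real.exp (M.b * t) * (1 + P t) := by
  set F : ℝ → ℝ := fun t => Real.exp (M.b * t) * (1 + P t) with hF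
  -- Only the restriction of P to [0, D] is known to be measurable, hence the indicator.
  have hmeas : AEMeasurable ((Icc 0 M.D).indicator F) := by
    refine (aemeasurable_indicator_iff measurableSet_Icc).2 (AEMeasurable.mul ?_ ?_)
    · exact (by fun_prop : Measurable fun t : ℝ => Real.exp (M.b * t)).aemeasurable
    · exact hP.feasible.integrable.aemeasurable.const_add 1
  by_contra! hcon
  obtain ⟨h1, h2⟩ := hcon
  obtain ⟨A, mA, hA, hPA, pA⟩ := exists_measurable_subset_of_not_ae (p := fun t => F t ≤ c') (by
    convert (measurableSet_Ioo (a := (0 : ℝ)) (b := m)).nullMeasurableSet.inter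
      (nullMeasurableSet_lt (aemeasurable_const (b := c')) hmeas) using 1
    ext t
    refine and_congr_right fun ht => ?_
    simp only [mem_ofPred_eq, not_le]
    have htI : t ∈ Icc 0 M.D := ⟨ht.1.le, ht.2.le.trans hm.2⟩
    rw [indicator_of_mem htI])
    (fun h => by
      obtain ⟨t, ht⟩ := (h1.and_eventually h).exists
      exact absurd (ht.2 ht.1.1) (not_le.2 ht.1.2))
  obtain ⟨B, mB, hB, hPB, pB⟩ := exists_measurable_subset_of_not_ae (p := fun t => c ≤ F t) (by
    convert (measurableSet_Ioo (a := m) (b := M.D)).nullMeasurableSet.inter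
      (nullMeasurableSet_lt hmeas (aemeasurable_const (b := c))) using 1
    ext t
    refine and_congr_right fun ht => ?_
    simp only [mem_ofPred_eq, not_le]
    have htI : t ∈ Icc 0 M.D := ⟨hm.1.trans ht.1.le, ht.2.le⟩
    rw [indicator_of_mem htI])
    (fun h => by
      obtain ⟨t, ht⟩ := (h2.and_eventually h).exists
      exact absurd (ht.2 ht.1.1) (not_le.2 ht.1.2))
  exact hP.no_exchange mA mB hm hA hB pA pB hc (fun t ht => not_le.1 (hPA t ht))
    fun t ht => not_le.1 (hPB t ht)

/-- For an optimal policy, `e ^ (b t) (1 + P t)` is nondecreasing up to a null set. -/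
theorem IsOptimal.exists_monotoneOn (hP : M.IsOptimal P) :
    ∃ S : Set ℝ, (∀ᵐ t, t ∈ S) ∧
      MonotoneOn (fun t => Real.exp (M.b * t) * (1 + P t)) (S ∩ Ioo 0 M.D) := by
  set F : ℝ → ℝ := fun t => Real.exp (M.b * t) * (1 + P t) with hF
  -- Rational parameters make S conull as a countable intersection. A failure of monotonicity leaves
  -- room for a rational m in time and rationals c < c' in level.
  let S : Set ℝ := {t | ∀ m c c' : ℚ,
    ((∀ᵐ r, r ∈ Ioo (0 : ℝ) m → F r ≤ c') → t ∈ Ioo (0 : ℝ) m → F t ≤ c') ∧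
    ((∀ᵐ r, r ∈ Ioo (m : ℝ) M.D → c ≤ F r) → t ∈ Ioo (m : ℝ) M.D → c ≤ F t)}
  refine ⟨S, ?_, fun t ht t' ht' htt => ?_⟩
  · refine ae_all_iff.2 fun m => ae_all_iff.2 fun c => ae_all_iff.2 fun c' => ?_
    refine Filter.Eventually.and ?_ ?_
    · by_cases h : ∀ᵐ r, r ∈ Ioo (0 : ℝ) m → F r ≤ c'
      · filter_upwards [h] with t ht _ using ht
      · exact ae_of_all _ fun t h' => absurd h' h
    · by_cases h : ∀ᵐ r, r ∈ Ioo (m : ℝ) M.D → c ≤ F r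
      · filter_upwards [h] with t ht _ using ht
      · exact ae_of_all _ fun t h' => absurd h' h
  · by_contra! hlt
    have hne : t < t' := htt.lt_of_ne fun h => by simp [h] at hlt
    obtain ⟨m, htm, hmt⟩ := exists_rat_btwn hne
    obtain ⟨c', hc1, hc2⟩ := exists_rat_btwn hlt
    obtain ⟨c, hc3, hc4⟩ := exists_rat_btwn hc1
    rcases hP.ae_le_or_ae_ge (m := m) ⟨(ht.2.1.trans htm).le, (hmt.trans ht'.2.2).le⟩ hc4 with h | h
    · exact absurd ((ht.1 m c c').1 h ⟨ht.2.1, htm⟩) (not_le.2 hc2)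
    · exact absurd ((ht'.1 m c c').2 h ⟨hmt, ht'.2.2⟩) (not_le.2 hc3)

/-! ### Heat balance around a time at critical temperature -/

theorem IsFeasible.heat_le (hP : M.IsFeasible P) {t : ℝ} (ht : t ∈ Icc 0 M.D) :
    M.a * (∫ τ in (0 : ℝ)..t, Real.exp (M.b * τ) * P τ) ≤ M.Tδ * Real.exp (M.b * t) := by
  have h := hP.temp t ht
  rw [temperature_eq (hP.intervalIntegrable (left_mem_Icc.2 M.D_pos.le) ht), Real.exp_neg,
    ← le_sub_iff_add_le', mul_left_comm, inv_mul_le_iff₀ (Real.exp_pos _)] at h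
  rwa [Tδ, mul_comm (M.Tc - M.Te)]

theorem IsFeasible.heat_eq (hP : M.IsFeasible P) {t : ℝ} (ht : t ∈ Icc 0 M.D)
    (h : M.temperature P t = M.Tc) :
    M.a * (∫ τ in (0 : ℝ)..t, Real.exp (M.b * τ) * P τ) = M.Tδ * Real.exp (M.b * t) := by
  have h1 : Real.exp (-(M.b * t)) * Real.exp (M.b * t) = 1 := by rw [← Real.exp_add]; simp
  rw [temperature_eq (hP.intervalIntegrable (left_mem_Icc.2 M.D_pos.le) ht)] at h
  rw [Tδ]
  linear_combination Real.exp (M.b * t) * h -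
    (M.a * ∫ τ in (0 : ℝ)..t, Real.exp (M.b * τ) * P τ) * h1

/-- The graph of exp lies above its tangents. It holds for either order of x and y, and both are
needed. -/
theorem mul_exp_le_exp_sub_exp (b x y : ℝ) :
    b * (y - x) * Real.exp (b * x) ≤ Real.exp (b * y) - Real.exp (b * x) := by
  have h1 : Real.exp (b * y) = Real.exp (b * (y - x)) * Real.exp (b * x) := by
    rw [← Real.exp_add]; ring_nf
  nlinarith [Real.add_one_le_exp (b * (y - x)), Real.exp_pos (b * x)]

theorem IsFeasible.intervalIntegrable_heat (hP : M.IsFeasible P) {x y : ℝ} (hx : x ∈ Icc 0 M.D)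
    (hy : y ∈ Icc 0 M.D) :
    IntervalIntegrable (fun τ => Real.exp (M.b * τ) * P τ) volume x y :=
  (hP.intervalIntegrable hx hy).continuousOn_mul (by fun_prop)

open Filter Topology in
/-- Before the critical temperature is reached at `t`, the policy cannot stay below the level that
keeps this temperature. -/
theorem IsFeasible.le_of_ae_le (hP : M.IsFeasible P) {t c : ℝ} (ht : t ∈ Ioo 0 M.D)
    (hT : M.temperature P t = M.Tc)
    (hc : ∀ᵐ τ, τ ∈ Ioo 0 t → Real.exp (M.b * τ) * (1 + P τ) ≤ c) :
    (M.a + M.Tδ * M.b) * Real.exp (M.b * t) ≤ M.a * c := by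
  have h0 : (0 : ℝ) ∈ Icc 0 M.D := left_mem_Icc.2 M.D_pos.le
  have htI : t ∈ Icc 0 M.D := Ioo_subset_Icc_self ht
  -- On [r, t] the heat gained is at most a (t - r) (c - e^(br)), but at least the rise of the
  -- ceiling, which is at least Tδ b (t - r) e^(br). Divide by t - r; afterwards r tends to t.
  have key : ∀ r ∈ Ioo 0 t, (M.a + M.Tδ * M.b) * Real.exp (M.b * r) ≤ M.a * c := by
    intro r hr
    have hrI : r ∈ Icc 0 M.D := ⟨hr.1.le, (hr.2.trans ht.2).le⟩
    have h1 : ∫ τ in r..t, Real.exp (M.b * τ) * P τ ≤ ∫ τ in r..t, (c - Real.exp (M.b * r)) := by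
      refine intervalIntegral.integral_mono_ae_restrict hr.2.le
        (hP.intervalIntegrable_heat hrI htI) (by simp) ?_
      refine (ae_restrict_iff' measurableSet_Icc).2 ?_
      filter_upwards [hc, Measure.ae_ne volume t] with τ hτ hne hm
      have h2 := hτ ⟨hr.1.trans_le hm.1, hm.2.lt_of_ne hne⟩
      have h3 : Real.exp (M.b * r) ≤ Real.exp (M.b * τ) :=
        Real.exp_le_exp.2 (mul_le_mul_of_nonneg_left hm.1 M.b_nonneg)
      linarith
    rw [intervalIntegral.integral_const, smul_eq_mul] at h1
    have h2 := intervalIntegral.integral_add_adjacent_intervals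
      (hP.intervalIntegrable_heat h0 hrI) (hP.intervalIntegrable_heat hrI htI)
    have h3 := hP.heat_eq htI hT
    have h4 := hP.heat_le hrI
    rw [← h2, mul_add] at h3
    have h5 := mul_le_mul_of_nonneg_left h1 M.a_nonneg
    have h6 := mul_le_mul_of_nonneg_left (mul_exp_le_exp_sub_exp M.b r t) M.Tδ_pos.le
    refine le_of_mul_le_mul_left ?_ (sub_pos.2 hr.2)
    nlinarith
  have hcont : Tendsto (fun r => (M.a + M.Tδ * M.b) * Real.exp (M.b * r)) (𝓝[<] t)
      (𝓝 ((M.a + M.Tδ * M.b) * Real.exp (M.b * t))) :=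
    (by fun_prop : Continuous fun r => (M.a + M.Tδ * M.b) * Real.exp (M.b * r)).tendsto t
      |>.mono_left nhdsWithin_le_nhds
  exact le_of_tendsto hcont (by filter_upwards [Ioo_mem_nhdsLT ht.1] with r hr using key r hr)

open Filter Topology in
/-- After the critical temperature is reached at `t`, the policy cannot stay above the level that
keeps this temperature. -/
theorem IsFeasible.ge_of_ae_ge (hP : M.IsFeasible P) {t c : ℝ} (ht : t ∈ Ioo 0 M.D)
    (hT : M.temperature P t = M.Tc)
    (hc : ∀ᵐ τ, τ ∈ Ioo t M.D → c ≤ Real.exp (M.b * τ) * (1 + P τ)) :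
    M.a * c ≤ (M.a + M.Tδ * M.b) * Real.exp (M.b * t) := by
  have h0 : (0 : ℝ) ∈ Icc 0 M.D := left_mem_Icc.2 M.D_pos.le
  have htI : t ∈ Icc 0 M.D := Ioo_subset_Icc_self ht
  -- Mirror image: on [t, r] the heat gained is at least a (r - t) (c - e^(br)), and the ceiling
  -- rises by at most Tδ b (r - t) e^(br).
  have key : ∀ r ∈ Ioo t M.D, M.a * c ≤ (M.a + M.Tδ * M.b) * Real.exp (M.b * r) := by
    intro r hr
    have hrI : r ∈ Icc 0 M.D := ⟨(ht.1.trans hr.1).le, hr.2.le⟩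
    have h1 : ∫ τ in t..r, (c - Real.exp (M.b * r)) ≤ ∫ τ in t..r, Real.exp (M.b * τ) * P τ := by
      refine intervalIntegral.integral_mono_ae_restrict hr.1.le (by simp)
        (hP.intervalIntegrable_heat htI hrI) ?_
      refine (ae_restrict_iff' measurableSet_Icc).2 ?_
      filter_upwards [hc, Measure.ae_ne volume t] with τ hτ hne hm
      have h2 := hτ ⟨hm.1.lt_of_ne' hne, hm.2.trans_lt hr.2⟩
      have h3 : Real.exp (M.b * τ) ≤ Real.exp (M.b * r) :=
        Real.exp_le_exp.2 (mul_le_mul_of_nonneg_left hm.2 M.b_nonneg)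
      linarith
    rw [intervalIntegral.integral_const, smul_eq_mul] at h1
    have h2 := intervalIntegral.integral_add_adjacent_intervals
      (hP.intervalIntegrable_heat h0 htI) (hP.intervalIntegrable_heat htI hrI)
    have h3 := hP.heat_eq htI hT
    have h4 := hP.heat_le hrI
    rw [← h2, mul_add] at h4
    have h5 := mul_le_mul_of_nonneg_left h1 M.a_nonneg
    have h6 := mul_le_mul_of_nonneg_left (mul_exp_le_exp_sub_exp M.b r t) M.Tδ_pos.le
    refine le_of_mul_le_mul_left ?_ (sub_pos.2 hr.1)
    nlinarith
  have hcont : Tendsto (fun r => (M.a + M.Tδ * M.b) * Real.exp (M.b * r)) (𝓝[>] t)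
      (𝓝 ((M.a + M.Tδ * M.b) * Real.exp (M.b * t))) :=
    (by fun_prop : Continuous fun r => (M.a + M.Tδ * M.b) * Real.exp (M.b * r)).tendsto t
      |>.mono_left nhdsWithin_le_nhds
  exact ge_of_tendsto hcont (by filter_upwards [Ioo_mem_nhdsGT ht.2] with r hr using key r hr)

/-- The critical temperature is not reached at time `0`, nor at all without heating. -/
theorem IsFeasible.pos_of_temperature_eq (hP : M.IsFeasible P) {t : ℝ} (ht : t ∈ Ico 0 M.D)
    (hT : M.temperature P t = M.Tc) : 0 < M.a ∧ 0 < t := by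
  have htI : t ∈ Icc 0 M.D := Ico_subset_Icc_self ht
  have h := hP.heat_eq htI hT
  have hpos : 0 < M.Tδ * Real.exp (M.b * t) := mul_pos M.Tδ_pos (Real.exp_pos _)
  refine ⟨M.a_nonneg.lt_of_ne fun h0 => ?_, ht.1.lt_of_ne fun h0 => ?_⟩
  · rw [← h0, zero_mul] at h
    exact hpos.ne h
  · subst h0
    rw [intervalIntegral.integral_same, mul_zero] at h
    exact hpos.ne h

end EHTransmitter

/-! ### The continuous version and its value -/

open Filter Topology in
-- By monotonicity a bound at one point on one side of t holds on a neighbourhood of t. Hence g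
-- tends to k along the full `𝓝 t`, which includes t itself and so fixes the value there.
theorem MonotoneOn.continuousAt_and_eq {g : ℝ → ℝ} {x y t k : ℝ} (hg : MonotoneOn g (Ioo x y))
    (ht : t ∈ Ioo x y) (hl : ∀ c < k, ∃ r ∈ Ioo x t, c < g r)
    (hr : ∀ c > k, ∃ r ∈ Ioo t y, g r < c) : ContinuousAt g t ∧ g t = k := by
  have hI : Ioo x y ∈ 𝓝 t := Ioo_mem_nhds ht.1 ht.2
  have htend : Tendsto g (𝓝 t) (𝓝 k) := by
    refine tendsto_order.2 ⟨fun c hc => ?_, fun c hc => ?_⟩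
    · obtain ⟨r, hr, hcr⟩ := hl c hc
      filter_upwards [hI, Ioi_mem_nhds hr.2] with z hz hrz
      exact hcr.trans_le (hg ⟨hr.1, hr.2.trans ht.2⟩ hz hrz.le)
    · obtain ⟨r, hr, hcr⟩ := hr c hc
      filter_upwards [hI, Iio_mem_nhds hr.1] with z hz hrz
      exact (hg hz ⟨ht.1.trans hr.1, hr.2⟩ hrz.le).trans_lt hcr
  have hgt : g t = k := tendsto_nhds_unique (tendsto_pure_nhds g t) (htend.mono_left (pure_le_nhds t))
  exact ⟨by rwa [ContinuousAt, hgt], hgt⟩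

open EHTransmitter in
theorem lemma9 (M : EHTransmitter) (P : ℝ → ℝ) (hP : M.IsOptimal P) :
    ∃ Q : ℝ → ℝ, M.IsOptimal Q ∧ (∀ᵐ t, t ∈ Icc 0 M.D → Q t = P t) ∧
      ∀ t_h ∈ Ico 0 M.D, M.temperature P t_h = M.Tc →
        ContinuousAt Q t_h ∧ Q t_h = M.Tδ * M.b / M.a := by
  obtain ⟨S, hS, hmono⟩ := hP.exists_monotoneOn
  obtain ⟨G, hG, hGF⟩ := hmono.exists_extension_Ioo (Measure.dense_of_ae hS)
  have hinv : ∀ t : ℝ, Real.exp (-(M.b * t)) * Real.exp (M.b * t) = 1 := fun t => by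
    rw [← Real.exp_add]; simp
  -- Solves e^(bt) (1 + Q) = G for Q; the maximum with 0 ensures nonnegativity also where G is not
  -- tied to P.
  let Q : ℝ → ℝ := (Ioo 0 M.D).piecewise (fun t => max 0 (Real.exp (-(M.b * t)) * G t - 1))
    fun t => max 0 (P t)
  have hQ0 : ∀ t, 0 ≤ Q t := fun t => by
    by_cases h : t ∈ Ioo 0 M.D <;> simp [Q, h]
  have hQP : ∀ᵐ t, t ∈ Icc 0 M.D → Q t = P t := by
    filter_upwards [hS] with t ht htI
    have h0 := hP.feasible.nonneg t htI
    by_cases h : t ∈ Ioo 0 M.D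
    · simp only [Q, piecewise_eq_of_mem _ _ _ h]
      rw [hGF ⟨ht, h⟩, ← mul_assoc, hinv, one_mul, add_sub_cancel_left, max_eq_right h0]
    · simp only [Q, piecewise_eq_of_notMem _ _ _ h]
      exact max_eq_right h0
  refine ⟨Q, hP.congr hQP fun t _ => hQ0 t, hQP, fun t ht hT => ?_⟩
  obtain ⟨ha, ht0⟩ := hP.feasible.pos_of_temperature_eq ht hT
  have htI : t ∈ Ioo 0 M.D := ⟨ht0, ht.2⟩
  obtain ⟨hcont, hval⟩ := hG.continuousAt_and_eq
    -- The level of F that corresponds to the power Tδ b / a at time t.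
    (k := (M.a + M.Tδ * M.b) * Real.exp (M.b * t) / M.a) htI (fun c hc => by
      by_contra! hcon
      rw [lt_div_iff₀ ha, mul_comm] at hc
      refine hc.not_ge (hP.feasible.le_of_ae_le htI hT ?_)
      filter_upwards [hS] with τ hτ hm
      exact (hGF ⟨hτ, hm.1, hm.2.trans ht.2⟩).symm.trans_le (hcon τ hm)) (fun c hc => by
      by_contra! hcon
      rw [gt_iff_lt, div_lt_iff₀ ha, mul_comm c] at hc
      refine hc.not_ge (hP.feasible.ge_of_ae_ge htI hT ?_)
      filter_upwards [hS] with τ hτ hm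
      exact (hcon τ hm).trans_eq (hGF ⟨hτ, ht0.trans hm.1, hm.2⟩))
  have hQt : Real.exp (-(M.b * t)) * G t - 1 = M.Tδ * M.b / M.a := by
    have : M.a ≠ 0 := ha.ne'
    rw [hval]
    field_simp
    linear_combination (M.a + M.Tδ * M.b) * hinv t
  constructor
  · have h1 : ContinuousAt (fun t => max 0 (Real.exp (-(M.b * t)) * G t - 1)) t := by
      fun_prop
    refine h1.congr ?_
    filter_upwards [Ioo_mem_nhds htI.1 htI.2] with r hr
    simp only [Q, piecewise_eq_of_mem _ _ _ hr]
  · simp only [Q, piecewise_eq_of_mem _ _ _ htI, hQt]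
    exact max_eq_right (div_nonneg (mul_nonneg M.Tδ_pos.le M.b_nonneg) ha.le)
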